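/- Let $m\ge 1$, $\boldsymbol\mu\in[0,1]^m$, $\boldsymbol\gamma\in[-1,1]^m$, $\epsilon\in[0,1]$, $R\in\mathbb R$, $\lambda>0$ and $\zeta\in(0,1)$. On a probability space let random vectors $\boldsymbol x_t$ and real random variables $u_t,h_t$ ($t=1,2,\dots$) be given. Put $\eta_t=u_t+h_t$, $y_t=\boldsymbol\mu^\top\boldsymbol x_t+\eta_t$ and $F_t=\sigma(\boldsymbol x_1,\dots,\boldsymbol x_t,\eta_1,\dots,\eta_{t-1})$. Assume that for every $t\ge1$, almost surely, $\boldsymbol x_t\in[0,1]^m$, $\boldsymbol\mu^\top\boldsymbol x_t\in[0,1]$, $y_t\in[0,1]$, $|u_t|\le 2R$, $\mathbb E[u_t\mid F_t]=0$, and that, conditionally on $F_t$, $h_t$ equals $\boldsymbol\gamma^\top\boldsymbol x_t$ with probability $\epsilon$ and $0$ with probability $1-\epsilon$. (The contexts $\boldsymbol x_t$ may depend on the past.) Let $$\boldsymbol M_t=\lambda\boldsymbol I_m+\sum_{i=1}^{t-1}\boldsymbol x_i\boldsymbol x_i^\top,\qquad \hat{\boldsymbol\mu}_t=\boldsymbol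 M_t^{-1}\sum_{i=1}^{t-1}\boldsymbol x_iy_i,\qquad \|\boldsymbol v\|_{\boldsymbol A}=\sqrt{\boldsymbol v^\top\boldsymbol A\boldsymbol v},$$ $$\mathcal C_t=\Big\{\boldsymbol\beta\in\mathbb R^m:\ \|\boldsymbol\beta-\hat{\boldsymbol\mu}_t\|_{\boldsymbol M_t}\le 2(R+1)\sqrt{m\log\big(tm/(\lambda\zeta)\big)}+\epsilon m\sqrt t+\sqrt{\lambda m}\Big\}.$$ Then, with probability at least $1-\zeta$, $\boldsymbol\mu\in\mathcal C_t$ simultaneously for all $t\ge1$ such that $\lambda\le m(t+1)/2$. (For $0<\lambda\le m$, in particular for $\lambda=1$, these are all $t\ge 1$.) -/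

import Mathlib

open MeasureTheory ProbabilityTheory
open scoped Matrix

noncomputable section

namespace BiasedLinear

/-- The weighted norm `‖v‖_A = √(vᵀ A v)` of a vector `v` for a square matrix `A`. -/
def matNorm {m : ℕ} (A : Matrix (Fin m) (Fin m) ℝ) (v : Fin m → ℝ) : ℝ :=
  Real.sqrt (v ⬝ᵥ (A *ᵥ v))

/-- `M_t = λ I + ∑_{i=1}^{t-1} x_i x_iᵀ`. -/
def gram {m : ℕ} (lam : ℝ) (x : ℕ → Fin m → ℝ) (t : ℕ) : Matrix (Fin m) (Fin m) ℝ :=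
  lam • (1 : Matrix (Fin m) (Fin m) ℝ) + ∑ i ∈ Finset.Ico 1 t, Matrix.vecMulVec (x i) (x i)

/-- The regularized least-squares estimate `M_t⁻¹ ∑_{i=1}^{t-1} y_i x_i`. -/
def ridge {m : ℕ} (lam : ℝ) (x : ℕ → Fin m → ℝ) (y : ℕ → ℝ) (t : ℕ) : Fin m → ℝ :=
  (gram lam x t)⁻¹ *ᵥ ∑ i ∈ Finset.Ico 1 t, y i • x i

/-- The radius `2(R+1) √(m log(t m / (λ ζ))) + ε m √t + √(λ m)`. -/
def radius (m : ℕ) (lam R ε ζ : ℝ) (t : ℕ) : ℝ :=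
  2 * (R + 1) * Real.sqrt ((m : ℝ) * Real.log ((t : ℝ) * (m : ℝ) / (lam * ζ)))
    + ε * (m : ℝ) * Real.sqrt (t : ℝ) + Real.sqrt (lam * (m : ℝ))

/-- The confidence ellipsoid at time `t`, computed from contexts `x` and responses `y`. -/
def ellipsoid {m : ℕ} (lam R ε ζ : ℝ) (x : ℕ → Fin m → ℝ) (y : ℕ → ℝ) (t : ℕ) :
    Set (Fin m → ℝ) :=
  {β | matNorm (gram lam x t) (β - ridge lam x y t) ≤ radius m lam R ε ζ t}

/-- The error term `η_t = u_t + h_t`. -/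
def noise {Ω : Type*} (u h : ℕ → Ω → ℝ) (t : ℕ) (ω : Ω) : ℝ := u t ω + h t ω

/-- The response `y_t = μᵀ x_t + η_t`. -/
def response {Ω : Type*} {m : ℕ} (μ : Fin m → ℝ) (x : ℕ → Ω → Fin m → ℝ)
    (u h : ℕ → Ω → ℝ) (t : ℕ) (ω : Ω) : ℝ :=
  μ ⬝ᵥ x t ω + noise u h t ω

/-- The information `F_t = σ(x_1, …, x_t, η_1, …, η_{t-1})` available when `y_t` is drawn. -/
@[reducible] def history {Ω : Type*} {m : ℕ} (x : ℕ → Ω → Fin m → ℝ) (u h : ℕ → Ω → ℝ) (t : ℕ) :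
    MeasurableSpace Ω :=
  (⨆ i ∈ Finset.Icc 1 t, MeasurableSpace.comap (x i) inferInstance) ⊔
    (⨆ i ∈ Finset.Ico 1 t, MeasurableSpace.comap (noise u h i) inferInstance)

/-- The linear model with a context-dependent bias in the error. Periods are `t = 1, 2, …`.
The contexts may be chosen adaptively. -/
structure IsModel {Ω : Type*} [MeasurableSpace Ω] {m : ℕ} (P : Measure Ω)
    (μ γ : Fin m → ℝ) (ε R : ℝ) (x : ℕ → Ω → Fin m → ℝ) (u h : ℕ → Ω → ℝ) : Prop where
  param_mem : ∀ j, μ j ∈ Set.Icc (0 : ℝ) 1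
  bias_mem : ∀ j, γ j ∈ Set.Icc (-1 : ℝ) 1
  prob_mem : ε ∈ Set.Icc (0 : ℝ) 1
  measurable_x : ∀ t, 1 ≤ t → Measurable (x t)
  measurable_u : ∀ t, 1 ≤ t → Measurable (u t)
  measurable_h : ∀ t, 1 ≤ t → Measurable (h t)
  context_mem : ∀ t, 1 ≤ t → ∀ᵐ ω ∂P, ∀ j, x t ω j ∈ Set.Icc (0 : ℝ) 1
  mean_mem : ∀ t, 1 ≤ t → ∀ᵐ ω ∂P, μ ⬝ᵥ x t ω ∈ Set.Icc (0 : ℝ) 1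
  response_mem : ∀ t, 1 ≤ t → ∀ᵐ ω ∂P, response μ x u h t ω ∈ Set.Icc (0 : ℝ) 1
  abs_u_le : ∀ t, 1 ≤ t → ∀ᵐ ω ∂P, |u t ω| ≤ 2 * R
  condExp_u : ∀ t, 1 ≤ t → P[u t | history x u h t] =ᵐ[P] 0
  /-- `h_t` is either `0` or `γᵀ x_t` … -/
  h_mem : ∀ t, 1 ≤ t → ∀ᵐ ω ∂P, h t ω = 0 ∨ h t ω = γ ⬝ᵥ x t ω
  /-- … and given the history it is `γᵀ x_t` with probability `ε`, hence `0` with probability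
  `1 - ε`; where `γᵀ x_t = 0` the two branches coincide and nothing is to be required. -/
  prob_h : ∀ t, 1 ≤ t → ∀ᵐ ω ∂P, γ ⬝ᵥ x t ω ≠ 0 →
    (P[Set.indicator {ω' | h t ω' = γ ⬝ᵥ x t ω'} (fun _ => (1 : ℝ)) | history x u h t]) ω = ε

end BiasedLinear

end

/-! Centre the error at its conditional mean: `ξ_t = η_t - ε γᵀx_t`. Both `η_t` and its conditional
mean lie in the interval `[-μᵀx_t, 1 - μᵀx_t]`, so `ξ` is a martingale difference with `|ξ_t| ≤ 1`.

Pathwise, `μ - μ̂_t` splits into a noise term `M_t⁻¹S_t`, a bias term and a regularization term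
(`sub_ridge_eq`). The last two have `M_t`-norm at most `ε m √t` and `√(λm)`.

For the noise term, rank-one updates of `M_t` give a recursion for `S_tᵀM_t⁻¹S_t` and for `det M_t`.
One step multiplies `exp(S_tᵀM_t⁻¹S_t / 2)` by at most `1 + s` times `1 + ξ_t · stake`, where `s` is
the leverage and the stake is predictable (`exp_increment_le`). Hence this exponential is at most
`det M_t / λ^m` times the wealth of a bettor, a nonnegative martingale starting at 1. No integration
over a mixture is needed; the price is `det` instead of `√det`, which the constant 2 in the radius
absorbs.

Ville's inequality keeps the wealth below `1/ζ` at all times with probability at least `1 - ζ`, and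
AM-GM on eigenvalues bounds the determinant. -/

namespace BiasedLinear

/-! ### Linear algebra of Gram matrices and weighted norms. -/

section Deterministic

variable {m : ℕ}

lemma dotProduct_vecMulVec_mulVec (x v w : Fin m → ℝ) :
    v ⬝ᵥ (Matrix.vecMulVec x x *ᵥ w) = (v ⬝ᵥ x) * (x ⬝ᵥ w) := by
  rw [Matrix.vecMulVec_mulVec]
  simp [dotProduct_smul, mul_comm]

lemma gram_succ (lam : ℝ) (x : ℕ → Fin m → ℝ) {t : ℕ} (ht : 1 ≤ t) :
    gram lam x (t + 1) = gram lam x t + Matrix.vecMulVec (x t) (x t) := by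
  simp only [gram]
  rw [Finset.sum_Ico_succ_top ht, add_assoc]

lemma gram_eq_add (lam : ℝ) (x : ℕ → Fin m → ℝ) (t : ℕ) :
    gram lam x t = lam • 1 + gram 0 x t := by
  simp [gram]

lemma gram_zero_posSemidef (x : ℕ → Fin m → ℝ) (t : ℕ) : (gram 0 x t).PosSemidef := by
  simp only [gram, zero_smul, zero_add]
  refine Matrix.posSemidef_sum _ fun i _ => ?_
  simpa using Matrix.posSemidef_vecMulVec_self_star (x i)

lemma gram_posDef {lam : ℝ} (hlam : 0 < lam) (x : ℕ → Fin m → ℝ) (t : ℕ) :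
    (gram lam x t).PosDef := by
  rw [gram_eq_add]
  exact (Matrix.PosDef.one.smul hlam).add_posSemidef (gram_zero_posSemidef x t)

/-- The quadratic form `vᵀ (∑ x_i x_iᵀ) v` is a sum of squares. -/
lemma gram_zero_quadratic (x : ℕ → Fin m → ℝ) (t : ℕ) (v : Fin m → ℝ) :
    v ⬝ᵥ (gram 0 x t *ᵥ v) = ∑ i ∈ Finset.Ico 1 t, (v ⬝ᵥ x i) ^ 2 := by
  simp only [gram, zero_smul, zero_add, Matrix.sum_mulVec, dotProduct_sum]
  refine Finset.sum_congr rfl fun i _ => ?_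
  rw [dotProduct_vecMulVec_mulVec, dotProduct_comm (x i) v, sq]

lemma dotProduct_mulVec_symm {A : Matrix (Fin m) (Fin m) ℝ} (hA : A.IsHermitian)
    (v w : Fin m → ℝ) : v ⬝ᵥ (A *ᵥ w) = w ⬝ᵥ (A *ᵥ v) := by
  have hT : Aᵀ = A := by simpa [Matrix.IsHermitian] using hA
  rw [Matrix.dotProduct_mulVec, dotProduct_comm, ← Matrix.mulVec_transpose, hT]

lemma mulVec_inv_mulVec {A : Matrix (Fin m) (Fin m) ℝ} (hA : A.PosDef) (v : Fin m → ℝ) :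
    A *ᵥ (A⁻¹ *ᵥ v) = v := by
  rw [Matrix.mulVec_mulVec, Matrix.mul_nonsing_inv _ hA.det_pos.ne'.isUnit, Matrix.one_mulVec]

lemma inv_mulVec_mulVec {A : Matrix (Fin m) (Fin m) ℝ} (hA : A.PosDef) (v : Fin m → ℝ) :
    A⁻¹ *ᵥ (A *ᵥ v) = v := by
  rw [Matrix.mulVec_mulVec, Matrix.nonsing_inv_mul _ hA.det_pos.ne'.isUnit, Matrix.one_mulVec]

lemma dotProduct_mulVec_nonneg {A : Matrix (Fin m) (Fin m) ℝ} (hA : A.PosSemidef)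
    (v : Fin m → ℝ) : 0 ≤ v ⬝ᵥ (A *ᵥ v) := by
  simpa using hA.dotProduct_mulVec_nonneg v

open scoped MatrixOrder Matrix.Norms.L2Operator in
-- Factoring `A = BᴴB` turns the weighted norm of `v` into the Euclidean norm of `Bv`.
lemma matNorm_add_le {A : Matrix (Fin m) (Fin m) ℝ} (hA : A.PosSemidef) (v w : Fin m → ℝ) :
    matNorm A (v + w) ≤ matNorm A v + matNorm A w := by
  obtain ⟨B, rfl⟩ := CStarAlgebra.nonneg_iff_eq_star_mul_self.mp hA.nonneg
  have key : ∀ v, matNorm (star B * B) v = ‖WithLp.toLp 2 (B *ᵥ v)‖ := by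
    intro v
    rw [matNorm, EuclideanSpace.norm_eq, Matrix.star_eq_conjTranspose, ← Matrix.mulVec_mulVec, Matrix.dotProduct_mulVec]
    congr 1
    simp [Matrix.vecMul_transpose, dotProduct, sq]
  rw [key, key, key, Matrix.mulVec_add, WithLp.toLp_add]
  exact norm_add_le _ _

lemma matNorm_neg (A : Matrix (Fin m) (Fin m) ℝ) (v : Fin m → ℝ) :
    matNorm A (-v) = matNorm A v := by
  simp [matNorm, Matrix.mulVec_neg]

lemma matNorm_smul (A : Matrix (Fin m) (Fin m) ℝ) {c : ℝ} (hc : 0 ≤ c) (v : Fin m → ℝ) :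
    matNorm A (c • v) = c * matNorm A v := by
  simp only [matNorm, Matrix.mulVec_smul, dotProduct_smul, smul_dotProduct, smul_eq_mul]
  rw [← mul_assoc, Real.sqrt_mul (by positivity), Real.sqrt_mul_self hc]

/-- For `g = (A + B)⁻¹ A v` with `A`, `B` positive semidefinite,
`gᵀ (A + B) g ≤ vᵀ A v`. -/
lemma quadratic_inv_le {A B : Matrix (Fin m) (Fin m) ℝ} (hA : A.PosSemidef) (hB : B.PosSemidef)
    {g v : Fin m → ℝ} (hg : (A + B) *ᵥ g = A *ᵥ v) :
    g ⬝ᵥ ((A + B) *ᵥ g) ≤ v ⬝ᵥ (A *ᵥ v) := by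
  -- Expanding this square and using `gᵀAv = gᵀ(A + B)g` gives `vᵀAv ≥ gᵀAg + 2gᵀBg`.
  have h1 := dotProduct_mulVec_nonneg hA (v - g)
  have h2 := dotProduct_mulVec_nonneg hB g
  have h3 : g ⬝ᵥ ((A + B) *ᵥ g) = g ⬝ᵥ (A *ᵥ v) := by rw [hg]
  have h4 := dotProduct_mulVec_symm hA.isHermitian v g
  rw [Matrix.add_mulVec, dotProduct_add] at h3 ⊢
  simp only [Matrix.mulVec_sub, dotProduct_sub, sub_dotProduct] at h1
  linarith

/-! ### Pathwise domination of the self-normalized sum by betting wealth. -/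

/-- The noise-weighted sum of the contexts before time `t`. -/
noncomputable def score (x : ℕ → Fin m → ℝ) (ξ : ℕ → ℝ) (t : ℕ) : Fin m → ℝ :=
  ∑ i ∈ Finset.Ico 1 t, ξ i • x i

/-- The squared norm of the score for the inverse Gram matrix. -/
noncomputable def scoreSq (lam : ℝ) (x : ℕ → Fin m → ℝ) (ξ : ℕ → ℝ) (t : ℕ) : ℝ :=
  score x ξ t ⬝ᵥ ((gram lam x t)⁻¹ *ᵥ score x ξ t)

/-- The leverage `x_tᵀ M_t⁻¹ x_t`. -/
noncomputable def leverage (lam : ℝ) (x : ℕ → Fin m → ℝ) (t : ℕ) : ℝ :=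
  x t ⬝ᵥ ((gram lam x t)⁻¹ *ᵥ x t)

/-- The cross term `x_tᵀ M_t⁻¹ S_t`. -/
noncomputable def cross (lam : ℝ) (x : ℕ → Fin m → ℝ) (ξ : ℕ → ℝ) (t : ℕ) : ℝ :=
  x t ⬝ᵥ ((gram lam x t)⁻¹ *ᵥ score x ξ t)

lemma leverage_nonneg {lam : ℝ} (hlam : 0 < lam) (x : ℕ → Fin m → ℝ) (t : ℕ) :
    0 ≤ leverage lam x t :=
  dotProduct_mulVec_nonneg (gram_posDef hlam x t).inv.posSemidef _

/-- Matrix determinant lemma for a rank-one update. -/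
lemma det_gram_succ {lam : ℝ} (hlam : 0 < lam) (x : ℕ → Fin m → ℝ) {t : ℕ} (ht : 1 ≤ t) :
    (gram lam x (t + 1)).det = (gram lam x t).det * (1 + leverage lam x t) := by
  rw [gram_succ lam x ht, Matrix.vecMulVec_eq Unit,
    Matrix.det_add_replicateCol_mul_replicateRow (gram_posDef hlam x t).det_pos.ne'.isUnit]
  congr 1
  rw [Matrix.det_unique, Matrix.add_apply, Matrix.one_apply_eq, Matrix.mul_assoc,
    ← Matrix.replicateCol_mulVec, Matrix.replicateRow_mul_replicateCol_apply, leverage]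

lemma scoreSq_succ {lam : ℝ} (hlam : 0 < lam) (x : ℕ → Fin m → ℝ) (ξ : ℕ → ℝ) {t : ℕ}
    (ht : 1 ≤ t) :
    scoreSq lam x ξ (t + 1) = scoreSq lam x ξ t +
      (2 * cross lam x ξ t * ξ t + leverage lam x t * ξ t ^ 2 - cross lam x ξ t ^ 2)
        / (1 + leverage lam x t) := by
  have hs := leverage_nonneg hlam x t
  have hM := gram_posDef hlam x t
  have hS : score x ξ (t + 1) = score x ξ t + ξ t • x t := by
    simp only [score]; rw [Finset.sum_Ico_succ_top ht]
  have hsym : score x ξ t ⬝ᵥ ((gram lam x t)⁻¹ *ᵥ x t) = cross lam x ξ t :=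
    dotProduct_mulVec_symm hM.inv.isHermitian _ _
  set p := (gram lam x t)⁻¹ *ᵥ score x ξ t with hp
  set q := (gram lam x t)⁻¹ *ᵥ x t with hq
  have hb : x t ⬝ᵥ p = cross lam x ξ t := rfl
  have hl : x t ⬝ᵥ q = leverage lam x t := rfl
  have hQ : score x ξ t ⬝ᵥ p = scoreSq lam x ξ t := rfl
  set b := cross lam x ξ t
  set s := leverage lam x t
  -- Sherman–Morrison applied to the updated score, checked by multiplying by `M_{t+1}`.
  have hinv : (gram lam x (t + 1))⁻¹ *ᵥ score x ξ (t + 1) = p + ((ξ t - b) / (1 + s)) • q := by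
    rw [← inv_mulVec_mulVec (gram_posDef hlam x (t + 1)) (p + ((ξ t - b) / (1 + s)) • q)]
    congr 1
    rw [gram_succ lam x ht, Matrix.add_mulVec, Matrix.mulVec_add, Matrix.mulVec_smul, hp, hq,
      mulVec_inv_mulVec hM, mulVec_inv_mulVec hM, ← hp, ← hq, Matrix.vecMulVec_mulVec,
      dotProduct_add, dotProduct_smul, hb, hl, hS]
    ext j
    simp only [Pi.add_apply, Pi.smul_apply, smul_eq_mul, MulOpposite.smul_eq_mul_unop,
      MulOpposite.unop_op]
    field_simp
    ring
  rw [scoreSq, hinv, hS]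
  simp only [add_dotProduct, dotProduct_add, smul_dotProduct, dotProduct_smul, smul_eq_mul, hb, hl,
    hsym, hQ]
  field_simp
  ring

/-- The stake placed on `ξ_t` by the betting martingale. -/
noncomputable def stake (lam : ℝ) (x : ℕ → Fin m → ℝ) (ξ : ℕ → ℝ) (t : ℕ) : ℝ :=
  Real.exp (-(cross lam x ξ t ^ 2 / (2 * (1 + leverage lam x t)))) *
    Real.sinh (cross lam x ξ t / (1 + leverage lam x t))

/-- The wealth of the betting martingale. -/
noncomputable def wealth (lam : ℝ) (x : ℕ → Fin m → ℝ) (ξ : ℕ → ℝ) (t : ℕ) : ℝ :=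
  ∏ i ∈ Finset.Ico 1 t, (1 + ξ i * stake lam x ξ i)

lemma wealth_succ (lam : ℝ) (x : ℕ → Fin m → ℝ) (ξ : ℕ → ℝ) {t : ℕ} (ht : 1 ≤ t) :
    wealth lam x ξ (t + 1) = wealth lam x ξ t * (1 + ξ t * stake lam x ξ t) := by
  simp only [wealth]
  rw [Finset.prod_Ico_succ_top ht]

lemma exp_neg_mul_cosh_le_one (b : ℝ) {s : ℝ} (hs : 0 ≤ s) :
    Real.exp (-(b ^ 2 / (2 * (1 + s)))) * Real.cosh (b / (1 + s)) ≤ 1 := by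
  have h1 := Real.cosh_le_exp_half_sq (b / (1 + s))
  have h2 : (b / (1 + s)) ^ 2 / 2 ≤ b ^ 2 / (2 * (1 + s)) := by
    rw [div_pow, div_div]
    refine div_le_div_of_nonneg_left (sq_nonneg b) (by positivity) (by nlinarith)
  calc _ ≤ Real.exp (-(b ^ 2 / (2 * (1 + s)))) * Real.exp (b ^ 2 / (2 * (1 + s))) := by
        gcongr
        exact h1.trans (Real.exp_le_exp.2 h2)
    _ = 1 := by rw [← Real.exp_add]; simp

/-- From `|sinh| ≤ cosh` and the preceding bound. With `|ξ_t| ≤ 1` it keeps the wealth nonnegative.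
-/
lemma abs_stake_le_one {lam : ℝ} (hlam : 0 < lam) (x : ℕ → Fin m → ℝ) (ξ : ℕ → ℝ) (t : ℕ) :
    |stake lam x ξ t| ≤ 1 := by
  refine le_trans ?_ (exp_neg_mul_cosh_le_one (cross lam x ξ t) (leverage_nonneg hlam x t))
  rw [stake, abs_mul, Real.abs_exp]
  gcongr
  exact abs_le.2 ⟨by have := Real.exp_pos (cross lam x ξ t / (1 + leverage lam x t))
                     rw [← Real.cosh_add_sinh] at this; linarith, (Real.sinh_lt_cosh _).le⟩

lemma wealth_factor_nonneg {lam : ℝ} (hlam : 0 < lam) (x : ℕ → Fin m → ℝ) (ξ : ℕ → ℝ) {t : ℕ}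
    (h : |ξ t| ≤ 1) : 0 ≤ 1 + ξ t * stake lam x ξ t := by
  have h1 : |ξ t * stake lam x ξ t| ≤ 1 := by
    rw [abs_mul]
    exact mul_le_one₀ h (abs_nonneg _) (abs_stake_le_one hlam x ξ t)
  linarith [(abs_le.1 h1).1]

/-- The exponent splits into a part quadratic in `z`, paid for by the determinant factor via
`s/(1+s) ≤ log(1+s)`, and an affine part. By convexity the exponential of the latter lies below its
chord on `[-1,1]`, whose constant coefficient is at most 1. -/
lemma exp_increment_le (b : ℝ) {s z : ℝ} (hs : 0 ≤ s) (hz : |z| ≤ 1) :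
    Real.exp ((2 * b * z + s * z ^ 2 - b ^ 2) / (1 + s) / 2) ≤
      (1 + s) * (1 + z * (Real.exp (-(b ^ 2 / (2 * (1 + s)))) * Real.sinh (b / (1 + s)))) := by
  have hsplit : (2 * b * z + s * z ^ 2 - b ^ 2) / (1 + s) / 2 =
      s * z ^ 2 / (2 * (1 + s)) + (-(b ^ 2 / (2 * (1 + s))) + z * (b / (1 + s))) := by
    field_simp; ring
  rw [hsplit, Real.exp_add, Real.exp_add]
  have hz2 : z ^ 2 ≤ 1 := (sq_le_one_iff_abs_le_one z).2 hz
  have h1 : Real.exp (s * z ^ 2 / (2 * (1 + s))) ≤ 1 + s := by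
    rw [← Real.le_log_iff_exp_le (by positivity)]
    refine le_trans ?_ (Real.one_sub_inv_le_log_of_pos (by positivity))
    rw [div_le_iff₀ (by positivity)]
    field_simp
    nlinarith
  have h2 : Real.exp (z * (b / (1 + s))) ≤
      Real.cosh (b / (1 + s)) + z * Real.sinh (b / (1 + s)) :=
    Real.exp_mul_le_cosh_add_mul_sinh hz _
  have h3 := exp_neg_mul_cosh_le_one b hs
  refine mul_le_mul h1 ?_ (by positivity) (by positivity)
  calc _ ≤ Real.exp (-(b ^ 2 / (2 * (1 + s)))) *
        (Real.cosh (b / (1 + s)) + z * Real.sinh (b / (1 + s))) := by gcongr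
    _ ≤ _ := by linarith

/-- The exponentiated self-normalized sum is dominated by the wealth. -/
lemma exp_scoreSq_le {lam : ℝ} (hlam : 0 < lam) (x : ℕ → Fin m → ℝ) (ξ : ℕ → ℝ)
    (hξ : ∀ i, 1 ≤ i → |ξ i| ≤ 1) {t : ℕ} (ht : 1 ≤ t) :
    Real.exp (scoreSq lam x ξ t / 2) ≤ (gram lam x t).det / lam ^ m * wealth lam x ξ t := by
  induction t, ht using Nat.le_induction with
  | base => simp [scoreSq, score, wealth, gram, hlam.ne']
  | succ t ht ih =>
    rw [scoreSq_succ hlam x ξ ht, det_gram_succ hlam x ht, wealth_succ lam x ξ ht, add_div,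
      Real.exp_add]
    refine (mul_le_mul ih (exp_increment_le _ (leverage_nonneg hlam x t) (hξ t ht))
      (Real.exp_pos _).le ((Real.exp_pos _).le.trans ih)).trans_eq ?_
    rw [stake]
    ring

/-! ### Growth of the determinant. -/

lemma det_le_trace_div_pow {A : Matrix (Fin m) (Fin m) ℝ} (hA : A.PosSemidef) (hm : 0 < m) :
    A.det ≤ (A.trace / m) ^ m := by
  have hm' : (0 : ℝ) < m := by exact_mod_cast hm
  have h := Real.geom_mean_le_arith_mean (Finset.univ : Finset (Fin m)) (fun _ => (1 : ℝ))
    hA.isHermitian.eigenvalues (fun _ _ => zero_le_one) (by simpa using hm)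
    (fun i _ => hA.eigenvalues_nonneg i)
  have hd : A.det = ∏ i, hA.isHermitian.eigenvalues i := by
    simpa using hA.isHermitian.det_eq_prod_eigenvalues
  have htr : A.trace = ∑ i, hA.isHermitian.eigenvalues i := by
    simpa using hA.isHermitian.trace_eq_sum_eigenvalues
  simp only [Real.rpow_one, one_mul, Finset.sum_const, Finset.card_univ, Fintype.card_fin,
    nsmul_eq_mul, mul_one] at h
  rw [← hd, ← htr] at h
  calc A.det = (A.det ^ ((m : ℝ)⁻¹)) ^ m := (Real.rpow_inv_natCast_pow hA.det_nonneg hm.ne').symm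
    _ ≤ _ := pow_le_pow_left₀ (Real.rpow_nonneg hA.det_nonneg _) h m

lemma det_gram_le {lam : ℝ} (hlam : 0 < lam) (hm : 0 < m) (x : ℕ → Fin m → ℝ)
    (hx : ∀ i, 1 ≤ i → ∀ j, x i j ∈ Set.Icc (0 : ℝ) 1) {t : ℕ} (ht : 1 ≤ t) :
    (gram lam x t).det / lam ^ m ≤ (1 + (t - 1) / lam) ^ m := by
  have hm' : (0 : ℝ) < m := by exact_mod_cast hm
  have htr : (gram lam x t).trace ≤ m * (lam + (t - 1)) := by
    have : ∀ i ∈ Finset.Ico 1 t, (Matrix.vecMulVec (x i) (x i)).trace ≤ m := by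
      intro i hi
      rw [Matrix.trace]
      refine (Finset.sum_le_card_nsmul _ _ 1 fun j _ => ?_).trans_eq (by simp)
      have := hx i (Finset.mem_Ico.1 hi).1 j
      simp only [Matrix.diag_apply, Matrix.vecMulVec_apply]
      exact mul_le_one₀ this.2 this.1 this.2
    have h2 := Finset.sum_le_card_nsmul _ _ _ this
    rw [gram, Matrix.trace_add, Matrix.trace_smul, Matrix.trace_one, Matrix.trace_sum]
    simp only [Nat.card_Ico, nsmul_eq_mul, Nat.cast_sub ht, Nat.cast_one, smul_eq_mul,
      Fintype.card_fin] at h2 ⊢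
    linarith
  have htr0 : 0 ≤ (gram lam x t).trace := (gram_posDef hlam x t).posSemidef.trace_nonneg
  rw [div_le_iff₀ (by positivity), ← mul_pow]
  refine (det_le_trace_div_pow (gram_posDef hlam x t).posSemidef hm).trans
    (pow_le_pow_left₀ (by positivity) ?_ m)
  rw [div_le_iff₀ hm']
  field_simp
  linarith

/-- After clearing denominators the left side increases with `lam`, so the worst case is `lam =
a(t+1)/2`. There four times the gap is exactly the product in `h2`. -/
lemma one_add_div_le_sq {lam a t : ℝ} (hlam : 0 < lam) (ha : 1 ≤ a) (ht : 1 ≤ t)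
    (h : lam ≤ a * (t + 1) / 2) : 1 + (t - 1) / lam ≤ (t * a / lam) ^ 2 := by
  have h1 : lam * (lam + (t - 1)) ≤ a * (t + 1) / 2 * (a * (t + 1) / 2 + (t - 1)) :=
    mul_le_mul h (by linarith) (by linarith) (by nlinarith)
  have h2 : 0 ≤ a * (t - 1) * (a * (3 * t + 1) - 2 * (t + 1)) :=
    mul_nonneg (mul_nonneg (by linarith) (by linarith)) (by nlinarith)
  rw [div_pow, le_div_iff₀ (by positivity)]
  field_simp
  nlinarith

/-! ### Error decomposition and membership in the ellipsoid. -/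

lemma gram_zero_mulVec (x : ℕ → Fin m → ℝ) (t : ℕ) (v : Fin m → ℝ) :
    gram 0 x t *ᵥ v = ∑ i ∈ Finset.Ico 1 t, (v ⬝ᵥ x i) • x i := by
  simp only [gram, zero_smul, zero_add, Matrix.sum_mulVec]
  refine Finset.sum_congr rfl fun i _ => ?_
  rw [Matrix.vecMulVec_mulVec, dotProduct_comm (x i) v]
  simp

lemma sub_ridge_eq {lam ε : ℝ} (hlam : 0 < lam) (x : ℕ → Fin m → ℝ) (y ξ : ℕ → ℝ)
    (μ γ : Fin m → ℝ) (hy : ∀ i, 1 ≤ i → y i = μ ⬝ᵥ x i + (ξ i + ε * (γ ⬝ᵥ x i))) (t : ℕ) :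
    μ - ridge lam x y t = -((gram lam x t)⁻¹ *ᵥ score x ξ t) +
      -(ε • ((gram lam x t)⁻¹ *ᵥ (gram 0 x t *ᵥ γ))) + (gram lam x t)⁻¹ *ᵥ (lam • μ) := by
  have hsum : ∑ i ∈ Finset.Ico 1 t, y i • x i =
      gram 0 x t *ᵥ μ + (score x ξ t + ε • (gram 0 x t *ᵥ γ)) := by
    rw [gram_zero_mulVec, gram_zero_mulVec, score, Finset.smul_sum, ← Finset.sum_add_distrib,
      ← Finset.sum_add_distrib]
    refine Finset.sum_congr rfl fun i hi => ?_
    rw [hy i (Finset.mem_Ico.1 hi).1, add_smul, add_smul, mul_smul]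
  have hμ : μ = (gram lam x t)⁻¹ *ᵥ (lam • μ) + (gram lam x t)⁻¹ *ᵥ (gram 0 x t *ᵥ μ) := by
    rw [← Matrix.mulVec_add]
    nth_rewrite 1 [← inv_mulVec_mulVec (gram_posDef hlam x t) μ]
    congr 1
    rw [gram_eq_add, Matrix.add_mulVec, Matrix.smul_mulVec, Matrix.one_mulVec]
  rw [ridge, hsum, Matrix.mulVec_add, Matrix.mulVec_add, Matrix.mulVec_smul _ ε]
  nth_rewrite 1 [hμ]
  abel

lemma matNorm_inv_score {lam : ℝ} (hlam : 0 < lam) (x : ℕ → Fin m → ℝ) (ξ : ℕ → ℝ) (t : ℕ) :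
    matNorm (gram lam x t) ((gram lam x t)⁻¹ *ᵥ score x ξ t) = √(scoreSq lam x ξ t) := by
  rw [matNorm, mulVec_inv_mulVec (gram_posDef hlam x t), dotProduct_comm, scoreSq]

lemma matNorm_regularization_le {lam : ℝ} (hlam : 0 < lam) (x : ℕ → Fin m → ℝ) {μ : Fin m → ℝ}
    (hμ : ∀ j, μ j ∈ Set.Icc (0 : ℝ) 1) (t : ℕ) :
    matNorm (gram lam x t) ((gram lam x t)⁻¹ *ᵥ (lam • μ)) ≤ √(lam * m) := by
  have hpsd : (lam • (1 : Matrix (Fin m) (Fin m) ℝ)).PosSemidef :=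
    (Matrix.PosDef.one.smul hlam).posSemidef
  have hg : gram lam x t *ᵥ ((gram lam x t)⁻¹ *ᵥ (lam • μ)) =
      (lam • (1 : Matrix (Fin m) (Fin m) ℝ)) *ᵥ μ := by
    rw [mulVec_inv_mulVec (gram_posDef hlam x t), Matrix.smul_mulVec, Matrix.one_mulVec]
  refine Real.sqrt_le_sqrt ?_
  -- Here `λI` is the distinguished summand; in `matNorm_bias_le` the roles are exchanged.
  have h := quadratic_inv_le hpsd (gram_zero_posSemidef x t)
    (g := (gram lam x t)⁻¹ *ᵥ (lam • μ)) (v := μ) (by rw [← gram_eq_add]; exact hg)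
  rw [← gram_eq_add] at h
  refine h.trans ?_
  rw [Matrix.smul_mulVec, Matrix.one_mulVec, dotProduct_smul, smul_eq_mul]
  gcongr
  refine (Finset.sum_le_card_nsmul _ _ 1 fun j _ => ?_).trans_eq (by simp)
  exact mul_le_one₀ (hμ j).2 (hμ j).1 (hμ j).2

lemma matNorm_bias_le {lam : ℝ} (hlam : 0 < lam) (x : ℕ → Fin m → ℝ)
    (hx : ∀ i, 1 ≤ i → ∀ j, x i j ∈ Set.Icc (0 : ℝ) 1) {γ : Fin m → ℝ}
    (hγ : ∀ j, γ j ∈ Set.Icc (-1 : ℝ) 1) (t : ℕ) :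
    matNorm (gram lam x t) ((gram lam x t)⁻¹ *ᵥ (gram 0 x t *ᵥ γ)) ≤ m * √t := by
  have hpsd : (lam • (1 : Matrix (Fin m) (Fin m) ℝ)).PosSemidef :=
    (Matrix.PosDef.one.smul hlam).posSemidef
  have hadd : gram lam x t = gram 0 x t + lam • 1 := by rw [gram_eq_add, add_comm]
  have h := quadratic_inv_le (gram_zero_posSemidef x t) hpsd
    (g := (gram lam x t)⁻¹ *ᵥ (gram 0 x t *ᵥ γ)) (v := γ)
    (by rw [← hadd]; exact mulVec_inv_mulVec (gram_posDef hlam x t) _)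
  rw [← hadd, gram_zero_quadratic] at h
  rw [matNorm]
  refine Real.sqrt_le_iff.2 ⟨by positivity, h.trans ?_⟩
  rw [mul_pow, Real.sq_sqrt (Nat.cast_nonneg t)]
  have hb : ∀ i ∈ Finset.Ico 1 t, (γ ⬝ᵥ x i) ^ 2 ≤ (m : ℝ) ^ 2 := by
    intro i hi
    refine sq_le_sq' ?_ ?_
    · have : ∑ j : Fin m, (-1 : ℝ) ≤ γ ⬝ᵥ x i := Finset.sum_le_sum fun j _ => by
        have h1 := hx i (Finset.mem_Ico.1 hi).1 j
        have h2 := hγ j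
        nlinarith [h1.1, h1.2, h2.1, h2.2]
      simpa using this
    · have : γ ⬝ᵥ x i ≤ ∑ j : Fin m, (1 : ℝ) := Finset.sum_le_sum fun j _ => by
        have h1 := hx i (Finset.mem_Ico.1 hi).1 j
        have h2 := hγ j
        nlinarith [h1.1, h1.2, h2.1, h2.2]
      simpa using this
  refine (Finset.sum_le_card_nsmul _ _ _ hb).trans ?_
  rw [nsmul_eq_mul, Nat.card_Ico, mul_comm]
  gcongr
  exact Nat.sub_le t 1

lemma scoreSq_le {lam ζ : ℝ} (hlam : 0 < lam) (hζ : ζ ∈ Set.Ioo (0 : ℝ) 1)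
    (x : ℕ → Fin m → ℝ) (hx : ∀ i, 1 ≤ i → ∀ j, x i j ∈ Set.Icc (0 : ℝ) 1) (ξ : ℕ → ℝ)
    (hξ : ∀ i, 1 ≤ i → |ξ i| ≤ 1) {t : ℕ} (ht : 1 ≤ t) (hle : lam ≤ (m : ℝ) * (t + 1) / 2)
    (hw : wealth lam x ξ t ≤ ζ⁻¹) :
    scoreSq lam x ξ t ≤ 4 * (m * Real.log (t * m / (lam * ζ))) := by
  -- For `m = 0` the condition on `lam` contradicts `0 < lam`.
  have hm : 0 < m := by
    rcases Nat.eq_zero_or_pos m with rfl | h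
    · simp at hle; linarith
    · exact h
  have hm1 : (1 : ℝ) ≤ m := by exact_mod_cast hm
  have ht1 : (1 : ℝ) ≤ t := by exact_mod_cast ht
  have hζ0 := hζ.1
  have ha : (0 : ℝ) < t * m / lam := by positivity
  have hexp : Real.exp (scoreSq lam x ξ t / 2) ≤ ((t * m / lam) ^ 2) ^ m * ζ⁻¹ := by
    refine (exp_scoreSq_le hlam x ξ hξ ht).trans (mul_le_mul ?_ hw ?_ (by positivity))
    · refine (det_gram_le hlam hm x hx ht).trans (pow_le_pow_left₀ ?_ ?_ m)
      · have : 0 ≤ ((t : ℝ) - 1) / lam := div_nonneg (by linarith) hlam.le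
        linarith
      · exact one_add_div_le_sq hlam hm1 ht1 hle
    · exact Finset.prod_nonneg fun i hi =>
        wealth_factor_nonneg hlam x ξ (hξ i (Finset.mem_Ico.1 hi).1)
  have hlog := (Real.le_log_iff_exp_le (by positivity)).2 hexp
  rw [Real.log_mul (by positivity) (by positivity), Real.log_pow, Real.log_pow, Real.log_inv]
    at hlog
  rw [← div_div, Real.log_div ha.ne' hζ0.ne']
  -- The logarithm gives `4m log(tm/λ) + 2 log(1/ζ)`; since `log(1/ζ) ≥ 0` and `m ≥ 1`, its
  -- coefficient 2 may be raised to `4m`.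
  have hlz : Real.log ζ ≤ 0 := Real.log_nonpos hζ0.le hζ.2.le
  push_cast at hlog
  nlinarith

lemma mem_ellipsoid {lam R ε ζ : ℝ} (hlam : 0 < lam) (hR : 0 ≤ R) (hε : 0 ≤ ε)
    (hζ : ζ ∈ Set.Ioo (0 : ℝ) 1) {μ γ : Fin m → ℝ} (hμ : ∀ j, μ j ∈ Set.Icc (0 : ℝ) 1)
    (hγ : ∀ j, γ j ∈ Set.Icc (-1 : ℝ) 1) {x : ℕ → Fin m → ℝ}
    (hx : ∀ i, 1 ≤ i → ∀ j, x i j ∈ Set.Icc (0 : ℝ) 1) {y ξ : ℕ → ℝ}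
    (hy : ∀ i, 1 ≤ i → y i = μ ⬝ᵥ x i + (ξ i + ε * (γ ⬝ᵥ x i)))
    (hξ : ∀ i, 1 ≤ i → |ξ i| ≤ 1) {t : ℕ} (ht : 1 ≤ t) (hle : lam ≤ (m : ℝ) * (t + 1) / 2)
    (hw : wealth lam x ξ t ≤ ζ⁻¹) : μ ∈ ellipsoid lam R ε ζ x y t := by
  have hM := (gram_posDef hlam x t).posSemidef
  rw [ellipsoid, Set.mem_ofPred_eq, sub_ridge_eq hlam x y ξ μ γ hy t]
  refine (matNorm_add_le hM _ _).trans ?_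
  rw [radius]
  refine add_le_add ((matNorm_add_le hM _ _).trans (add_le_add ?_ ?_))
    (matNorm_regularization_le hlam x hμ t)
  · rw [matNorm_neg, matNorm_inv_score hlam]
    have h := Real.sqrt_le_sqrt (scoreSq_le hlam hζ x hx ξ hξ ht hle hw)
    rw [Real.sqrt_mul (by norm_num), show (4 : ℝ) = 2 ^ 2 by norm_num,
      Real.sqrt_sq (by norm_num)] at h
    refine h.trans ?_
    -- The noise term needs only the coefficient 2, and `2 ≤ 2(R + 1)` because `R ≥ 0`.
    gcongr
    linarith
  · rw [matNorm_neg, matNorm_smul _ hε, mul_assoc]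
    gcongr
    exact matNorm_bias_le hlam x hx hγ t

end Deterministic
end BiasedLinear

namespace BiasedLinear

/-! ### Measurability of the stake and the wealth. -/

section Measurability

variable {Ω : Type*} [MeasurableSpace Ω] {m : ℕ}

lemma measurable_dotProduct {v w : Ω → Fin m → ℝ} (hv : Measurable v) (hw : Measurable w) :
    Measurable fun ω => v ω ⬝ᵥ w ω :=
  Finset.measurable_sum _ fun j _ => (hv.eval (a := j)).mul (hw.eval (a := j))

lemma measurable_det {n : Type*} [Fintype n] [DecidableEq n] {A : Ω → Matrix n n ℝ}
    (hA : ∀ i j, Measurable fun ω => A ω i j) : Measurable fun ω => (A ω).det := by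
  simp only [Matrix.det_apply]
  exact Finset.measurable_sum _ fun σ _ =>
    (Finset.measurable_prod _ fun i _ => hA (σ i) i).const_smul _

lemma measurable_matrix_inv_apply {A : Ω → Matrix (Fin m) (Fin m) ℝ}
    (hA : ∀ i j, Measurable fun ω => A ω i j) (i j : Fin m) :
    Measurable fun ω => (A ω)⁻¹ i j := by
  simp only [Matrix.inv_def, Matrix.smul_apply, Ring.inverse_eq_inv', Matrix.adjugate_apply,
    smul_eq_mul]
  refine (measurable_det hA).inv.mul (measurable_det fun k l => ?_)
  simp only [Matrix.updateRow_apply]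
  split_ifs
  · exact measurable_const
  · exact hA k l

lemma measurable_inv_mulVec {A : Ω → Matrix (Fin m) (Fin m) ℝ} {v : Ω → Fin m → ℝ}
    (hA : ∀ i j, Measurable fun ω => A ω i j) (hv : Measurable v) :
    Measurable fun ω => (A ω)⁻¹ *ᵥ v ω := by
  refine measurable_pi_iff.2 fun i => ?_
  simp only [Matrix.mulVec, dotProduct]
  exact Finset.measurable_sum _ fun j _ =>
    (measurable_matrix_inv_apply hA i j).mul (hv.eval (a := j))

variable {x : ℕ → Ω → Fin m → ℝ} {ξ : ℕ → Ω → ℝ} {t : ℕ}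

lemma measurable_gram_apply (lam : ℝ) (hx : ∀ i ∈ Finset.Ico 1 t, Measurable (x i))
    (j k : Fin m) : Measurable fun ω => gram lam (fun i => x i ω) t j k := by
  simp only [gram, Matrix.add_apply, Matrix.sum_apply, Matrix.vecMulVec_apply]
  exact measurable_const.add (Finset.measurable_sum _ fun i hi =>
    ((hx i hi).eval (a := j)).mul ((hx i hi).eval (a := k)))

lemma measurable_score (hx : ∀ i ∈ Finset.Ico 1 t, Measurable (x i))
    (hξ : ∀ i ∈ Finset.Ico 1 t, Measurable (ξ i)) :
    Measurable fun ω => score (fun i => x i ω) (fun i => ξ i ω) t :=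
  Finset.measurable_sum _ fun i hi => (hξ i hi).smul (hx i hi)

lemma measurable_stake (lam : ℝ) (hx : ∀ i ∈ Finset.Ico 1 t, Measurable (x i))
    (hxt : Measurable (x t)) (hξ : ∀ i ∈ Finset.Ico 1 t, Measurable (ξ i)) :
    Measurable fun ω => stake lam (fun i => x i ω) (fun i => ξ i ω) t := by
  have hb : Measurable fun ω => cross lam (fun i => x i ω) (fun i => ξ i ω) t :=
    measurable_dotProduct hxt
      (measurable_inv_mulVec (measurable_gram_apply lam hx) (measurable_score hx hξ))
  have hs : Measurable fun ω => leverage lam (fun i => x i ω) t :=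
    measurable_dotProduct hxt (measurable_inv_mulVec (measurable_gram_apply lam hx) hxt)
  simp only [stake]
  exact ((hb.pow_const 2).div ((hs.const_add 1).const_mul 2)).neg.exp.mul
    (Real.measurable_sinh.comp (hb.div (hs.const_add 1)))

lemma measurable_wealth (lam : ℝ) (hx : ∀ i ∈ Finset.Ico 1 t, Measurable (x i))
    (hξ : ∀ i ∈ Finset.Ico 1 t, Measurable (ξ i)) :
    Measurable fun ω => wealth lam (fun i => x i ω) (fun i => ξ i ω) t := by
  refine Finset.measurable_prod _ fun i hi => measurable_const.add ((hξ i hi).mul ?_)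
  have hsub : ∀ k ∈ Finset.Ico 1 i, k ∈ Finset.Ico 1 t := fun k hk => by
    simp only [Finset.mem_Ico] at hk hi ⊢; omega
  exact measurable_stake lam (fun k hk => hx k (hsub k hk)) (hx i hi)
    fun k hk => hξ k (hsub k hk)

end Measurability

/-! ### Ville's inequality and adaptedness to the history. -/

/-- **Ville's inequality** for an almost surely nonnegative martingale. -/
lemma measure_exists_le_martingale {Ω : Type*} {mΩ : MeasurableSpace Ω} {P : Measure Ω}
    [IsFiniteMeasure P] {ℱ : Filtration ℕ mΩ} {f : ℕ → Ω → ℝ} (hf : Martingale f ℱ P)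
    (h0 : ∀ n, 0 ≤ᵐ[P] f n) {c : ℝ} (hc : 0 < c) :
    P {ω | ∃ n, c ≤ f n ω} ≤ ENNReal.ofReal ((∫ ω, f 0 ω ∂P) / c) := by
  -- The maximal inequality asks for nonnegativity everywhere, so it is applied to the positive
  -- part, which agrees with `f` almost surely.
  have hsub : Submartingale (f⁺) ℱ P := hf.submartingale.pos
  have hunion : {ω | ∃ n, c ≤ f n ω} = ⋃ n, {ω | ∃ k ≤ n, c ≤ f k ω} := by
    ext ω
    simp only [Set.mem_ofPred_eq, Set.mem_iUnion]
    exact ⟨fun ⟨n, h⟩ => ⟨n, n, le_rfl, h⟩, fun ⟨n, k, _, h⟩ => ⟨k, h⟩⟩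
  have hmono : Monotone fun n => {ω | ∃ k ≤ n, c ≤ f k ω} :=
    fun a b hab ω ⟨k, hk, h⟩ => ⟨k, hk.trans hab, h⟩
  rw [hunion, hmono.measure_iUnion]
  refine iSup_le fun n => ?_
  have hmax := maximal_ineq hsub (fun k ω => le_sup_right) (ε := c.toNNReal) n
  rw [Real.coe_toNNReal c hc.le] at hmax
  have hint : ∫ ω, (f⁺) n ω ∂P = ∫ ω, f 0 ω ∂P := by
    have h1 : (f⁺) n =ᵐ[P] f n := by
      filter_upwards [h0 n] with ω hω
      exact sup_of_le_left hω
    rw [integral_congr_ae h1]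
    simpa using (hf.setIntegral_eq (Nat.zero_le n) MeasurableSet.univ).symm
  have hle : P {ω | ∃ k ≤ n, c ≤ f k ω} ≤ P {ω | c ≤ (Finset.range (n + 1)).sup'
      Finset.nonempty_range_add_one fun k => (f⁺) k ω} := by
    refine measure_mono fun ω ⟨k, hk, h⟩ => ?_
    rw [Set.mem_ofPred_eq, Finset.le_sup'_iff]
    exact ⟨k, Finset.mem_range.2 (by omega), h.trans le_sup_left⟩
  rw [ENNReal.ofReal_div_of_pos hc, ENNReal.le_div_iff_mul_le
    (Or.inl (by simpa using hc)) (Or.inl ENNReal.ofReal_ne_top), mul_comm]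
  refine (mul_le_mul_right hle _).trans (hmax.trans (ENNReal.ofReal_le_ofReal ?_))
  rw [← hint]
  exact setIntegral_le_integral (hsub.integrable n) (ae_of_all _ fun ω => le_sup_right)

/-- The error centred at its conditional mean `ε γᵀ x_t`. -/
noncomputable def centered {Ω : Type*} {m : ℕ} (γ : Fin m → ℝ) (ε : ℝ) (x : ℕ → Ω → Fin m → ℝ)
    (u h : ℕ → Ω → ℝ) (t : ℕ) (ω : Ω) : ℝ :=
  noise u h t ω - ε * (γ ⬝ᵥ x t ω)

section History

variable {Ω : Type*} {m : ℕ} {x : ℕ → Ω → Fin m → ℝ} {u h : ℕ → Ω → ℝ}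

lemma history_mono {s t : ℕ} (hst : s ≤ t) : history x u h s ≤ history x u h t := by
  refine sup_le_sup ?_ ?_
  · exact biSup_mono fun i hi => by simp only [Finset.mem_Icc] at hi ⊢; omega
  · exact biSup_mono fun i hi => by simp only [Finset.mem_Ico] at hi ⊢; omega

lemma measurable_context_history {i t : ℕ} (hi : i ∈ Finset.Icc 1 t) :
    Measurable[history x u h t] (x i) :=
  measurable_iff_comap_le.2 ((le_iSup₂_of_le (f := fun i (_ : i ∈ Finset.Icc 1 t) =>
    MeasurableSpace.comap (x i) inferInstance) i hi le_rfl).trans le_sup_left)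

lemma measurable_noise_history {i t : ℕ} (hi : i ∈ Finset.Ico 1 t) :
    Measurable[history x u h t] (noise u h i) :=
  measurable_iff_comap_le.2 ((le_iSup₂_of_le (f := fun i (_ : i ∈ Finset.Ico 1 t) =>
    MeasurableSpace.comap (noise u h i) inferInstance) i hi le_rfl).trans le_sup_right)

lemma measurable_bias_history (γ : Fin m → ℝ) {i t : ℕ} (hi : i ∈ Finset.Icc 1 t) :
    Measurable[history x u h t] fun ω => γ ⬝ᵥ x i ω :=
  @measurable_dotProduct Ω (history x u h t) m (fun _ => γ) (x i)
    (@measurable_const _ _ _ (history x u h t) γ) (measurable_context_history hi)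

lemma measurable_centered_history (γ : Fin m → ℝ) (ε : ℝ) {i t : ℕ} (hi : i ∈ Finset.Ico 1 t) :
    Measurable[history x u h t] (centered γ ε x u h i) :=
  (measurable_noise_history hi).sub ((measurable_bias_history γ
    (Finset.Ico_subset_Icc_self hi)).const_mul ε)

lemma measurable_stake_history (lam : ℝ) (γ : Fin m → ℝ) (ε : ℝ) {t : ℕ} (ht : 1 ≤ t) :
    Measurable[history x u h t] fun ω =>
      stake lam (fun i => x i ω) (fun i => centered γ ε x u h i ω) t :=
  @measurable_stake Ω (history x u h t) m x (centered γ ε x u h) t lam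
    (fun _ hi => measurable_context_history (Finset.Ico_subset_Icc_self hi))
    (measurable_context_history (Finset.mem_Icc.2 ⟨ht, le_rfl⟩))
    fun _ hi => measurable_centered_history γ ε hi

lemma measurable_wealth_history (lam : ℝ) (γ : Fin m → ℝ) (ε : ℝ) (t : ℕ) :
    Measurable[history x u h t] fun ω =>
      wealth lam (fun i => x i ω) (fun i => centered γ ε x u h i ω) t :=
  @measurable_wealth Ω (history x u h t) m x (centered γ ε x u h) t lam
    (fun _ hi => measurable_context_history (Finset.Ico_subset_Icc_self hi))
    fun _ hi => measurable_centered_history γ ε hi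

end History

/-! ### Conditional moments of the error and the wealth martingale. -/

namespace IsModel

variable {Ω : Type*} [mΩ : MeasurableSpace Ω] {P : Measure Ω} {m : ℕ} {μ γ : Fin m → ℝ}
  {ε R : ℝ} {x : ℕ → Ω → Fin m → ℝ} {u h : ℕ → Ω → ℝ}

lemma radius_nonneg [NeZero P] (H : IsModel P μ γ ε R x u h) : 0 ≤ R := by
  obtain ⟨ω, hω⟩ := (H.abs_u_le 1 le_rfl).exists
  linarith [abs_nonneg (u 1 ω)]

lemma history_le (H : IsModel P μ γ ε R x u h) (t : ℕ) : history x u h t ≤ mΩ := by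
  refine sup_le (iSup₂_le fun i hi => ?_) (iSup₂_le fun i hi => ?_)
  · exact (H.measurable_x i (Finset.mem_Icc.1 hi).1).comap_le
  · exact ((H.measurable_u i (Finset.mem_Ico.1 hi).1).add
      (H.measurable_h i (Finset.mem_Ico.1 hi).1)).comap_le

lemma abs_bias_le (H : IsModel P μ γ ε R x u h) {t : ℕ} (ht : 1 ≤ t) :
    ∀ᵐ ω ∂P, ‖γ ⬝ᵥ x t ω‖ ≤ m := by
  filter_upwards [H.context_mem t ht] with ω hω
  refine (norm_sum_le _ _).trans ((Finset.sum_le_card_nsmul _ _ 1 fun j _ => ?_).trans_eq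
    (by simp))
  rw [norm_mul]
  exact mul_le_one₀ (abs_le.2 (H.bias_mem j)) (norm_nonneg _)
    (abs_le.2 ⟨by linarith [(hω j).1], (hω j).2⟩)

variable [IsProbabilityMeasure P]

lemma integrable_bias (H : IsModel P μ γ ε R x u h) {t : ℕ} (ht : 1 ≤ t) :
    Integrable (fun ω => γ ⬝ᵥ x t ω) P :=
  .of_bound (measurable_dotProduct measurable_const (H.measurable_x t ht)).aestronglyMeasurable m
    (H.abs_bias_le ht)

lemma integrable_mean (H : IsModel P μ γ ε R x u h) {t : ℕ} (ht : 1 ≤ t) :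
    Integrable (fun ω => μ ⬝ᵥ x t ω) P :=
  .of_bound (measurable_dotProduct measurable_const (H.measurable_x t ht)).aestronglyMeasurable 1
    (by filter_upwards [H.mean_mem t ht] with ω hω
        exact abs_le.2 ⟨by linarith [hω.1], hω.2⟩)

lemma integrable_u (H : IsModel P μ γ ε R x u h) {t : ℕ} (ht : 1 ≤ t) : Integrable (u t) P :=
  .of_bound (H.measurable_u t ht).aestronglyMeasurable _ (H.abs_u_le t ht)

lemma integrable_h (H : IsModel P μ γ ε R x u h) {t : ℕ} (ht : 1 ≤ t) : Integrable (h t) P :=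
  .of_bound (H.measurable_h t ht).aestronglyMeasurable m (by
    filter_upwards [H.h_mem t ht, H.abs_bias_le ht] with ω h1 h2
    rcases h1 with h1 | h1
    · simp [h1]
    · rw [h1]; exact h2)

lemma condExp_h (H : IsModel P μ γ ε R x u h) {t : ℕ} (ht : 1 ≤ t) :
    P[h t | history x u h t] =ᵐ[P] fun ω => ε * (γ ⬝ᵥ x t ω) := by
  set A : Set Ω := {ω' | h t ω' = γ ⬝ᵥ x t ω'}
  have hA : MeasurableSet A := measurableSet_eq_fun (H.measurable_h t ht)
    (measurable_dotProduct measurable_const (H.measurable_x t ht))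
  -- Writing `h_t` as a history-measurable factor times an indicator lets the factor be pulled out;
  -- where it vanishes, the indicator's conditional probability is irrelevant.
  have h1 : h t =ᵐ[P] (fun ω => γ ⬝ᵥ x t ω) * A.indicator fun _ => (1 : ℝ) := by
    filter_upwards [H.h_mem t ht] with ω hω
    by_cases hmem : ω ∈ A
    · have hmem' : h t ω = γ ⬝ᵥ x t ω := hmem
      simp [hmem, hmem']
    · simpa [hmem] using hω.resolve_right hmem
  have hint : Integrable (A.indicator fun _ => (1 : ℝ)) P := (integrable_const 1).indicator hA
  have h2 := condExp_stronglyMeasurable_mul_of_bound (H.history_le t)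
    (measurable_bias_history (x := x) (u := u) (h := h) γ
      (Finset.mem_Icc.2 ⟨ht, le_rfl⟩)).stronglyMeasurable hint m (H.abs_bias_le ht)
  refine (condExp_congr_ae h1).trans (h2.trans ?_)
  filter_upwards [H.prob_h t ht] with ω hω
  rw [Pi.mul_apply]
  by_cases hz : γ ⬝ᵥ x t ω = 0
  · simp [hz]
  · rw [hω hz, mul_comm]

lemma condExp_noise (H : IsModel P μ γ ε R x u h) {t : ℕ} (ht : 1 ≤ t) :
    P[noise u h t | history x u h t] =ᵐ[P] fun ω => ε * (γ ⬝ᵥ x t ω) := by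
  refine (condExp_add (H.integrable_u ht) (H.integrable_h ht) _).trans ?_
  filter_upwards [H.condExp_u t ht, H.condExp_h ht] with ω h1 h2
  simp [h1, h2]

lemma integrable_noise (H : IsModel P μ γ ε R x u h) {t : ℕ} (ht : 1 ≤ t) :
    Integrable (noise u h t) P :=
  (H.integrable_u ht).add (H.integrable_h ht)

lemma integrable_centered (H : IsModel P μ γ ε R x u h) {t : ℕ} (ht : 1 ≤ t) :
    Integrable (centered γ ε x u h t) P :=
  (H.integrable_noise ht).sub ((H.integrable_bias ht).const_mul ε)

lemma condExp_centered (H : IsModel P μ γ ε R x u h) {t : ℕ} (ht : 1 ≤ t) :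
    P[centered γ ε x u h t | history x u h t] =ᵐ[P] 0 := by
  have hb : P[fun ω => ε * (γ ⬝ᵥ x t ω) | history x u h t] = fun ω => ε * (γ ⬝ᵥ x t ω) :=
    condExp_of_stronglyMeasurable (H.history_le t)
      ((measurable_bias_history γ (Finset.mem_Icc.2 ⟨ht, le_rfl⟩)).const_mul ε).stronglyMeasurable
      ((H.integrable_bias ht).const_mul ε)
  refine (condExp_sub (H.integrable_noise ht) ((H.integrable_bias ht).const_mul ε) _).trans ?_
  rw [hb]
  filter_upwards [H.condExp_noise ht] with ω h1
  simp [h1]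

/-- Given the history, the error lies in an interval of length one, and so does its mean. -/
lemma abs_centered_le_one (H : IsModel P μ γ ε R x u h) {t : ℕ} (ht : 1 ≤ t) :
    ∀ᵐ ω ∂P, |centered γ ε x u h t ω| ≤ 1 := by
  have hm := measurable_bias_history (x := x) (u := u) (h := h) μ
    (Finset.mem_Icc.2 ⟨ht, le_rfl⟩)
  have hlow : P[fun ω => -(μ ⬝ᵥ x t ω) | history x u h t] = fun ω => -(μ ⬝ᵥ x t ω) :=
    condExp_of_stronglyMeasurable (H.history_le t) hm.neg.stronglyMeasurable
      (H.integrable_mean ht).neg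
  have hupp : P[fun ω => 1 - μ ⬝ᵥ x t ω | history x u h t] = fun ω => 1 - μ ⬝ᵥ x t ω :=
    condExp_of_stronglyMeasurable (H.history_le t) (hm.const_sub 1).stronglyMeasurable
      ((integrable_const 1).sub (H.integrable_mean ht))
  have h1 := condExp_mono (m := history x u h t) (H.integrable_mean ht).neg (H.integrable_noise ht)
    (by filter_upwards [H.response_mem t ht] with ω hω
        have := hω.1
        simp only [response] at this
        simp only [Pi.neg_apply]
        linarith)
  have h2 := condExp_mono (m := history x u h t) (H.integrable_noise ht)
    ((integrable_const 1).sub (H.integrable_mean ht))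
    (by filter_upwards [H.response_mem t ht] with ω hω
        have := hω.2
        simp only [response] at this
        simp only [Pi.sub_apply]
        linarith)
  change P[fun ω => -(μ ⬝ᵥ x t ω) | history x u h t] ≤ᵐ[P] _ at h1
  change _ ≤ᵐ[P] P[fun ω => 1 - μ ⬝ᵥ x t ω | history x u h t] at h2
  rw [hlow] at h1
  rw [hupp] at h2
  filter_upwards [h1, h2, H.condExp_noise ht, H.response_mem t ht] with ω h1 h2 h3 h4
  rw [h3] at h1 h2
  simp only [response, Set.mem_Icc] at h4
  rw [centered, abs_le]
  constructor <;> linarith [h4.1, h4.2]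

/-- The filtration generated by the histories. -/
def filtration (H : IsModel P μ γ ε R x u h) : Filtration ℕ mΩ where
  -- The shift makes time 0 correspond to period 1. The history at `n + 1` already contains
  -- `x_{n+1}`, so the stake on `ξ_{n+1}` is predictable.
  seq n := history x u h (n + 1)
  mono' _ _ hab := history_mono (Nat.succ_le_succ hab)
  le' n := H.history_le (n + 1)

lemma ae_abs_centered_le_one (H : IsModel P μ γ ε R x u h) :
    ∀ᵐ ω ∂P, ∀ i, 1 ≤ i → |centered γ ε x u h i ω| ≤ 1 :=
  ae_all_iff.2 fun i => by
    by_cases hi : 1 ≤ i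
    · filter_upwards [H.abs_centered_le_one hi] with ω hω _ using hω
    · exact ae_of_all _ fun ω h => absurd h hi

/-- A crude bound, one factor 2 per round; it serves integrability and the pull-out property. -/
lemma abs_wealth_le (H : IsModel P μ γ ε R x u h) {lam : ℝ} (hlam : 0 < lam) (t : ℕ) :
    ∀ᵐ ω ∂P, ‖wealth lam (fun i => x i ω) (fun i => centered γ ε x u h i ω) t‖ ≤ 2 ^ (t - 1) := by
  filter_upwards [H.ae_abs_centered_le_one] with ω hω
  rw [wealth, norm_prod]
  refine (Finset.prod_le_prod (fun _ _ => norm_nonneg _) fun i hi => ?_).trans_eq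
    (by simp : ∏ _i ∈ Finset.Ico 1 t, (2 : ℝ) = 2 ^ (t - 1))
  refine (norm_add_le _ _).trans ?_
  rw [norm_mul, norm_one, ← one_add_one_eq_two]
  gcongr
  exact mul_le_one₀ (hω i (Finset.mem_Ico.1 hi).1) (norm_nonneg _) (abs_stake_le_one hlam _ _ i)

lemma martingale_wealth (H : IsModel P μ γ ε R x u h) {lam : ℝ} (hlam : 0 < lam) :
    Martingale (fun n ω =>
      wealth lam (fun i => x i ω) (fun i => centered γ ε x u h i ω) (n + 1)) H.filtration P := by
  have hmeas : ∀ t, Measurable[history x u h t] fun ω =>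
      wealth lam (fun i => x i ω) (fun i => centered γ ε x u h i ω) t :=
    measurable_wealth_history lam γ ε
  have hint : ∀ t, Integrable (fun ω =>
      wealth lam (fun i => x i ω) (fun i => centered γ ε x u h i ω) t) P := fun t =>
    .of_bound ((hmeas t).mono (H.history_le t) le_rfl).aestronglyMeasurable _
      (H.abs_wealth_le hlam t)
  refine martingale_nat (fun n => (hmeas (n + 1)).stronglyMeasurable) (fun n => hint _)
    fun n => ?_
  have hn : 1 ≤ n + 1 := Nat.le_add_left 1 n
  set D : Ω → ℝ := fun ω =>
    wealth lam (fun i => x i ω) (fun i => centered γ ε x u h i ω) (n + 1) *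
      stake lam (fun i => x i ω) (fun i => centered γ ε x u h i ω) (n + 1) with hD
  have hDm : Measurable[history x u h (n + 1)] D :=
    (hmeas (n + 1)).mul (measurable_stake_history lam γ ε hn)
  have hDb : ∀ᵐ ω ∂P, ‖D ω‖ ≤ 2 ^ n := by
    filter_upwards [H.abs_wealth_le hlam (n + 1)] with ω hω
    rw [hD, norm_mul]
    exact (mul_le_of_le_one_right (norm_nonneg _) (abs_stake_le_one hlam _ _ _)).trans hω
  have hsplit : (fun ω => wealth lam (fun i => x i ω) (fun i => centered γ ε x u h i ω)
      (n + 1 + 1)) = (fun ω => wealth lam (fun i => x i ω) (fun i => centered γ ε x u h i ω)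
      (n + 1)) + D * centered γ ε x u h (n + 1) := by
    ext ω
    rw [wealth_succ lam _ _ hn]
    simp only [Pi.add_apply, Pi.mul_apply, hD]
    ring
  have hDint : Integrable (D * centered γ ε x u h (n + 1)) P :=
    (H.integrable_centered hn).bdd_mul
      (hDm.mono (H.history_le _) le_rfl).aestronglyMeasurable hDb
  have hpull := condExp_stronglyMeasurable_mul_of_bound (H.history_le (n + 1))
    hDm.stronglyMeasurable (H.integrable_centered hn) _ hDb
  have hadd := condExp_add (hint (n + 1)) hDint (history x u h (n + 1))
  rw [condExp_of_stronglyMeasurable (H.history_le (n + 1)) (hmeas (n + 1)).stronglyMeasurable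
    (hint (n + 1))] at hadd
  change _ =ᵐ[P] P[_ | history x u h (n + 1)]
  rw [hsplit]
  filter_upwards [hadd, hpull, H.condExp_centered hn] with ω h1 h2 h3
  rw [h1, Pi.add_apply, h2, Pi.mul_apply, h3]
  simp

lemma measure_exists_wealth_ge (H : IsModel P μ γ ε R x u h) {lam ζ : ℝ} (hlam : 0 < lam)
    (hζ : 0 < ζ) : P {ω | ∃ n, ζ⁻¹ ≤
      wealth lam (fun i => x i ω) (fun i => centered γ ε x u h i ω) (n + 1)} ≤
      ENNReal.ofReal ζ := by
  refine (measure_exists_le_martingale (H.martingale_wealth hlam) (fun n => ?_)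
    (inv_pos.2 hζ)).trans_eq ?_
  · filter_upwards [H.ae_abs_centered_le_one] with ω hω
    exact Finset.prod_nonneg fun i hi =>
      wealth_factor_nonneg hlam (fun i => x i ω) (fun i => centered γ ε x u h i ω) (hω i (Finset.mem_Ico.1 hi).1)
  · simp [wealth]

end IsModel

end BiasedLinear

/-! ### Passage to the simultaneous probability bound. -/

theorem mainTheorem2 {Ω : Type*} [MeasurableSpace Ω] (P : Measure Ω) [IsProbabilityMeasure P]
    (m : ℕ) (μ γ : Fin m → ℝ) (ε R lam ζ : ℝ)
    (x : ℕ → Ω → Fin m → ℝ) (u h : ℕ → Ω → ℝ)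
    (hmodel : BiasedLinear.IsModel P μ γ ε R x u h)
    (hlam : 0 < lam) (hζ : ζ ∈ Set.Ioo (0 : ℝ) 1) :
    ENNReal.ofReal (1 - ζ) ≤
      P {ω | ∀ t : ℕ, 1 ≤ t → lam ≤ (m : ℝ) * ((t : ℝ) + 1) / 2 →
        μ ∈ BiasedLinear.ellipsoid lam R ε ζ (fun i => x i ω)
          (fun i => BiasedLinear.response μ x u h i ω) t} := by
  have hctx : ∀ᵐ ω ∂P, ∀ i, 1 ≤ i → ∀ j, x i ω j ∈ Set.Icc (0 : ℝ) 1 :=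
    ae_all_iff.2 fun i => by
      by_cases hi : 1 ≤ i
      · filter_upwards [hmodel.context_mem i hi] with ω hω _ using hω
      · exact ae_of_all _ fun ω h => absurd h hi
  set B : Set Ω := {ω | ∃ n, ζ⁻¹ ≤ BiasedLinear.wealth lam (fun i => x i ω)
    (fun i => BiasedLinear.centered γ ε x u h i ω) (n + 1)}
  have hB : MeasurableSet B := by
    have : B = ⋃ n, {ω | ζ⁻¹ ≤ BiasedLinear.wealth lam (fun i => x i ω)
        (fun i => BiasedLinear.centered γ ε x u h i ω) (n + 1)} := by
      ext ω; simp [B]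
    rw [this]
    exact MeasurableSet.iUnion fun n => measurableSet_le measurable_const
      ((BiasedLinear.measurable_wealth_history lam γ ε (n + 1)).mono
        (hmodel.history_le (n + 1)) le_rfl)
  calc ENNReal.ofReal (1 - ζ) = 1 - ENNReal.ofReal ζ := by
        rw [ENNReal.ofReal_sub _ hζ.1.le, ENNReal.ofReal_one]
    _ ≤ 1 - P B := tsub_le_tsub_left (hmodel.measure_exists_wealth_ge hlam hζ.1) 1
    _ = P Bᶜ := (prob_compl_eq_one_sub hB).symm
    -- An almost sure inclusion suffices, so the ellipsoid event need not be shown measurable.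
    _ ≤ _ := measure_mono_ae ?_
  filter_upwards [hctx, hmodel.ae_abs_centered_le_one] with ω hx hξ hω t ht hle
  refine BiasedLinear.mem_ellipsoid hlam hmodel.radius_nonneg hmodel.prob_mem.1 hζ
    hmodel.param_mem hmodel.bias_mem hx (fun i _ => ?_) hξ ht hle ?_
  · simp only [BiasedLinear.response, BiasedLinear.centered]
    ring
  · by_contra hcon
    -- `B` indexes the wealth by `n + 1`, so period `t ≥ 1` is `n = t - 1`.
    refine hω ⟨t - 1, ?_⟩
    rw [Nat.sub_add_cancel ht]
    exact (not_le.1 hcon).le
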